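/- For a finite group $G$, an integer $\ell\ge 1$ and $x\in G$, let $r_\ell(x)=|\{g\in G : g^\ell=x\}|$. For a square-free integer $d\ge 2$, one says that $G$ satisfies $\mathcal P(d)$ if there exist $a,b\in G$ of the same order such that $0=r_d(a)<r_d(b)$ and $r_\ell(a)=r_\ell(b)$ for all square-free integers $1<\ell<d$. Theorem. Let $p$ be a prime and let $G$ be a finite non-abelian $p$-group with center $Z(G)$. (1) Assume that $|G|=p^{m+n}$ for integers $1\le n<m$, that $G$ is not isomorphic to the quaternion group $Q_8$ of order $8$, and that $G$ contains an element of order $p^m$. Then $G$ satisfies $\mathcal P(p)$. (2) Assume that $G$ contains an element of order at least $\max(p^2,8)$. Then $G$ satisfies $\mathcal P(p)$, or for every $\alpha\in Z(G)$ of order $p$ the quotient $G/\langle\alpha\rangle$ satisfies $\mathcal P(p)$. Consequently, for every $\alpha\in Z(G)$ of order $p$, the group $G\times (G/\langle\alpha\rangle)$ satisfies $\mathcal P(p)$. -/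

import Mathlib

/-- The number `r_ℓ(x)` of `ℓ`-th roots of `x` in the (finite) group `G`. -/
noncomputable def rootCount {G : Type*} [Group G] (l : ℕ) (x : G) : ℕ :=
  Nat.card {g : G // g ^ l = x}

/-- `G` satisfies Property `𝒫(d)` relatively to `(a, b)`: the elements `a`, `b` have the same order,
`a` has no `d`-th root, `b` has a `d`-th root, and `a`, `b` have equally many `ℓ`-th roots for every
square-free `1 < ℓ < d`. It is used for finite groups `G` and square-free `d ≥ 2`. -/
def SatisfiesPRelativelyTo {G : Type*} [Group G] (d : ℕ) (a b : G) : Prop :=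
  orderOf a = orderOf b ∧ rootCount d a = 0 ∧ 0 < rootCount d b ∧
    ∀ l : ℕ, Squarefree l → 1 < l → l < d → rootCount l a = rootCount l b

/-- Property `𝒫(d)` of a finite group `G`. -/
def SatisfiesP (d : ℕ) (G : Type*) [Group G] : Prop :=
  ∃ a b : G, SatisfiesPRelativelyTo d a b

/-- The cyclic subgroup generated by a central element is normal, so that the quotient by it
is a group. -/
instance zpowers_center_normal {G : Type*} [Group G] (α : Subgroup.center G) :
    (Subgroup.zpowers (α : G)).Normal where
  conj_mem x hx g := by
    have hc : x ∈ Subgroup.center G := Subgroup.zpowers_le.mpr α.2 hx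
    rw [Subgroup.mem_center_iff.mp hc g, mul_inv_cancel_right]
    exact hx

open Subgroup

/-! In a `p`-group, failure of `𝒫(p)` means that any element with the order of a `p`-th power is
itself a `p`-th power. Extracting roots repeatedly then places every element of order `p` in a
cyclic subgroup of order `p ^ m` whenever such a subgroup exists. In (1), two such subgroups meet
non-trivially by counting, so there is only one subgroup of order `p`.

A non-abelian `p`-group with this uniqueness has `p = 2` and a non-square of order 4
(`exists_orderOf_four`, `pow_two_ne_of_conj_eq_pow`); an element of order 8 squares to one of order
4, giving `𝒫(2)`. Only `Q_8` escapes.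

In (2), let `p ^ e` be the exponent. If `α` lies in every cyclic subgroup of order `p ^ e`,
uniqueness holds again. Otherwise one such subgroup contains `α`, another avoids it, and their
generators yield `𝒫(p)` in the quotient. -/

/-- Any two non-trivial elements killed by `p` generate the same subgroup. -/
def HasUniquePrimeSubgroup (p : ℕ) (G : Type*) [Group G] : Prop :=
  ∀ u w : G, u ^ p = 1 → u ≠ 1 → w ^ p = 1 → w ∈ zpowers u

/-! ### Self-centralizing abelian normal subgroups -/

theorem IsPGroup.exists_mem_center_of_normal {p : ℕ} [Fact p.Prime] {G : Type*} [Group G]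
    [Finite G] (hG : IsPGroup p G) (N : Subgroup G) [N.Normal] {x : G} (hx : x ∈ N) (hx1 : x ≠ 1) :
    ∃ z ∈ N, z ∈ center G ∧ z ≠ 1 := by
  have hG' : IsPGroup p (ConjAct G) := hG
  have : Nontrivial N := ⟨⟨x, hx⟩, 1, fun h => hx1 (by simpa using congrArg Subtype.val h)⟩
  have hdvd : p ∣ Nat.card N := by
    obtain ⟨n, hn, h⟩ := (hG.to_subgroup N).nontrivial_iff_card.1 this
    exact h ▸ dvd_pow_self p hn.ne'
  obtain ⟨z, hz, hz1⟩ := hG'.exists_fixed_point_of_prime_dvd_card_of_fixed_point N hdvd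
    (a := 1) (fun g => smul_one g)
  refine ⟨z, z.2, mem_center_iff.2 fun g => ?_, fun h => hz1 (Subtype.ext h.symm)⟩
  have : g * z * g⁻¹ = z := congrArg Subtype.val (hz (ConjAct.toConjAct g))
  exact mul_inv_eq_iff_eq_mul.1 this

/-- Take `A` maximal among abelian normal subgroups. If its centralizer were larger, the
centralizer's image in `G ⧸ A` would contain a non-trivial central element, whose cyclic group pulls
back to a larger abelian normal subgroup. -/
theorem IsPGroup.exists_normal_abelian_self_centralizing {p : ℕ} [Fact p.Prime] {G : Type*}
    [Group G] [Finite G] (hG : IsPGroup p G) :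
    ∃ A : Subgroup G, A.Normal ∧ (∀ x ∈ A, ∀ y ∈ A, x * y = y * x) ∧
      ∀ x, (∀ y ∈ A, x * y = y * x) → x ∈ A := by
  obtain ⟨A, hA⟩ := (Set.toFinite {A : Subgroup G | A.Normal ∧
    ∀ x ∈ A, ∀ y ∈ A, x * y = y * x}).exists_maximal
    ⟨⊥, inferInstance, by simp +contextual⟩
  have hn := hA.prop.1
  have hcomm := hA.prop.2
  refine ⟨A, hn, hcomm, fun x hx => ?_⟩
  by_contra hxA
  have hxC : x ∈ centralizer (A : Set G) := mem_centralizer_iff.2 fun y hy => (hx y hy).symm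
  have hN : ((centralizer (A : Set G)).map (QuotientGroup.mk' A)).Normal :=
    Normal.map inferInstance _ (QuotientGroup.mk'_surjective A)
  obtain ⟨z, hzN, hzc, hz1⟩ := (hG.to_quotient A).exists_mem_center_of_normal
    ((centralizer (A : Set G)).map (QuotientGroup.mk' A)) (mem_map_of_mem _ hxC)
    (by simpa using hxA)
  obtain ⟨c, hc, rfl⟩ := mem_map.1 hzN
  have hc' : ∀ y ∈ A, Commute y c := fun y hy => mem_centralizer_iff.1 hc y hy
  have hBn : (zpowers (QuotientGroup.mk' A c)).Normal := zpowers_center_normal ⟨_, hzc⟩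
  have hle : A ≤ (zpowers (QuotientGroup.mk' A c)).comap (QuotientGroup.mk' A) := fun y hy => by
    rw [mem_comap, show QuotientGroup.mk' A y = 1 from (QuotientGroup.eq_one_iff y).2 hy]
    exact one_mem _
  have hform : ∀ y ∈ (zpowers (QuotientGroup.mk' A c)).comap (QuotientGroup.mk' A),
      ∃ n : ℤ, ∃ a ∈ A, y = c ^ n * a := by
    intro y hy
    obtain ⟨n, hn⟩ := mem_zpowers_iff.1 (mem_comap.1 hy)
    refine ⟨n, (c ^ n)⁻¹ * y, ?_, by group⟩
    rw [← QuotientGroup.eq]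
    simpa using hn
  have hB := hA.le_of_ge (y := (zpowers (QuotientGroup.mk' A c)).comap (QuotientGroup.mk' A))
    ⟨Normal.comap hBn _, fun y hy y' hy' => by
      obtain ⟨n, a, ha, rfl⟩ := hform y hy
      obtain ⟨m, b, hb, rfl⟩ := hform y' hy'
      have h1 : Commute a (c ^ m * b) :=
        ((hc' a ha).zpow_right m).mul_right (hcomm a ha b hb)
      have h2 : Commute (c ^ n) (c ^ m * b) :=
        ((Commute.refl c).zpow_zpow n m).mul_right ((hc' b hb).zpow_right n).symm
      exact h2.mul_left h1⟩ hle
  refine hz1 ((QuotientGroup.eq_one_iff c).2 (hB ?_))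
  exact mem_comap.2 (mem_zpowers _)

/-! ### Groups with a unique subgroup of order `p` -/

theorem mem_zpowers_pow_of_coprime {G : Type*} [Group G] {a : G} {j : ℕ}
    (h : (orderOf a).Coprime j) : a ∈ zpowers (a ^ j) :=
  mem_zpowers_pow_iff.2 (Nat.coprime_comm.1 h)

theorem IsPGroup.coprime_orderOf {p : ℕ} [Fact p.Prime] {G : Type*} [Group G]
    (hG : IsPGroup p G) (a : G) {j : ℕ} (hj : ¬ p ∣ j) : (orderOf a).Coprime j :=
  hG.orderOf_coprime ((Nat.Prime.coprime_iff_not_dvd Fact.out).2 hj) a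

theorem IsPGroup.exists_pow_order_prime {p : ℕ} [Fact p.Prime] {G : Type*} [Group G] [Finite G]
    (hG : IsPGroup p G) {a : G} (ha : a ≠ 1) : ∃ i : ℕ, orderOf (a ^ i) = p :=
  ⟨orderOf a / p, orderOf_pow_orderOf_div (orderOf_pos a).ne' (hG.dvd_orderOf ha)⟩

theorem HasUniquePrimeSubgroup.mem_zpowers_of_ne_one {p : ℕ} [Fact p.Prime] {G : Type*} [Group G]
    [Finite G] (H : HasUniquePrimeSubgroup p G) (hG : IsPGroup p G) {a w : G} (ha : a ≠ 1)
    (hw : w ^ p = 1) : w ∈ zpowers a := by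
  obtain ⟨i, hi⟩ := hG.exists_pow_order_prime ha
  obtain ⟨h1, h2⟩ := orderOf_eq_prime_iff.1 hi
  exact zpowers_le.2 (npow_mem_zpowers a i) (H _ w h1 h2 hw)

/-- An element `a` of maximal order generates. By induction `b ^ p = a ^ j`: if `p ∣ j`, dividing
`b` by a power of `a` leaves an element killed by `p`; if not, `b ^ p` generates `zpowers a`, so `b`
has order larger than `a`. -/
theorem HasUniquePrimeSubgroup.exists_generator {p : ℕ} [Fact p.Prime] {G : Type*} [Group G]
    [Finite G] (H : HasUniquePrimeSubgroup p G) (hG : IsPGroup p G) (A : Subgroup G)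
    (hA : ∀ x ∈ A, ∀ y ∈ A, x * y = y * x) : ∃ a, A = zpowers a := by
  obtain ⟨⟨a, ha⟩, hmax⟩ := Finite.exists_max (fun x : A => orderOf (x : G))
  refine ⟨a, le_antisymm ?_ (zpowers_le.2 ha)⟩
  intro b hb
  induction h : orderOf b using Nat.strong_induction_on generalizing b with
  | _ n ih =>
  subst h
  by_cases hb1 : b = 1
  · exact hb1 ▸ one_mem _
  have hlt : orderOf (b ^ p) < orderOf b := by
    rw [orderOf_pow_of_dvd (Nat.Prime.ne_zero Fact.out) (hG.dvd_orderOf hb1)]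
    exact Nat.div_lt_self (orderOf_pos b) (Nat.Prime.one_lt Fact.out)
  obtain ⟨j, hj⟩ := mem_powers_iff_mem_zpowers.2 (ih _ hlt (pow_mem hb p) rfl)
  replace hj : a ^ j = b ^ p := hj
  have hab : orderOf b ≤ orderOf a := hmax ⟨b, hb⟩
  by_cases hpj : p ∣ j
  · obtain ⟨i, rfl⟩ := hpj
    have ha1 : a ≠ 1 := by
      rintro rfl
      have := orderOf_pos b
      exact hb1 (orderOf_eq_one_iff.1 (by rw [orderOf_one] at hab; omega))
    have hc : Commute b (a ^ i)⁻¹ := (Commute.pow_right (hA b hb a ha) i).inv_right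
    have := H.mem_zpowers_of_ne_one hG ha1 (w := b * (a ^ i)⁻¹)
      (by rw [hc.mul_pow, ← hj, inv_pow, ← pow_mul, mul_comm i, mul_inv_cancel])
    exact ((zpowers a).mul_mem_cancel_right (inv_mem (npow_mem_zpowers a i))).1 this
  · have := mem_zpowers_pow_of_coprime (hG.coprime_orderOf a hpj)
    rw [hj] at this
    have := Nat.le_of_dvd (orderOf_pos _) (orderOf_dvd_of_mem_zpowers this)
    omega

theorem mul_pow_of_conj_eq_pow {G : Type*} [Group G] {a g : G} {s : ℕ}
    (h : g * a * g⁻¹ = a ^ s) (i n : ℕ) :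
    (a ^ i * g) ^ n = a ^ (i * ∑ k ∈ Finset.range n, s ^ k) * g ^ n := by
  have hs : ∀ k, g * a ^ k = a ^ (s * k) * g := fun k => by
    rw [← mul_inv_eq_iff_eq_mul, ← conj_pow, h, pow_mul]
  induction n with
  | zero => simp
  | succ n ih =>
    rw [pow_succ', ih, geom_sum_succ, mul_assoc, ← mul_assoc g, hs, mul_assoc, ← pow_succ',
      ← mul_assoc, ← pow_add]
    ring_nf

theorem Nat.Coprime.exists_dvd_mul_add {n t : ℕ} [NeZero n] (h : t.Coprime n) (j : ℕ) :
    ∃ i, n ∣ i * t + j := by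
  refine ⟨((-j : ZMod n) * (t : ZMod n)⁻¹).val, ?_⟩
  rw [← ZMod.natCast_eq_zero_iff]
  push_cast
  rw [ZMod.natCast_zmod_val, mul_assoc, mul_comm _ (t : ZMod n), ZMod.coe_mul_inv_eq_one t h]
  ring

/-- Since `(a ^ i * g) ^ p = a ^ (p * (i * t + j))` and `t` is invertible modulo the order of `a`,
some `i` makes this trivial. -/
theorem HasUniquePrimeSubgroup.mem_zpowers_of_geom_sum {p : ℕ} [Fact p.Prime] {G : Type*}
    [Group G] [Finite G] (H : HasUniquePrimeSubgroup p G) (hG : IsPGroup p G) {a g : G} {s j t : ℕ}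
    (ha : a ≠ 1) (h : g * a * g⁻¹ = a ^ s) (hj : g ^ p = a ^ (p * j))
    (ht : ∑ k ∈ Finset.range p, s ^ k = p * t) (hpt : ¬ p ∣ t) : g ∈ zpowers a := by
  have : NeZero (orderOf a) := ⟨(orderOf_pos a).ne'⟩
  obtain ⟨i, hi⟩ := (hG.coprime_orderOf a hpt).symm.exists_dvd_mul_add j
  have := H.mem_zpowers_of_ne_one hG ha (w := a ^ i * g) (by
    rw [mul_pow_of_conj_eq_pow h, ht, hj, ← pow_add, ← orderOf_dvd_iff_pow_eq_one]
    exact (hi.mul_left p).trans (dvd_of_eq (by ring)))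
  exact ((zpowers a).mul_mem_cancel_left (npow_mem_zpowers a i)).1 this

/-- The sum is congruent to `p` modulo `p ^ 2`. For `p = 2` it is `1 + s`, hence the condition
modulo 4. -/
theorem exists_geom_sum_eq_prime_mul {p s : ℕ} (hp : p.Prime)
    (hs : (p ≠ 2 ∧ s ≡ 1 [MOD p]) ∨ (p = 2 ∧ s ≡ 1 [MOD 4])) :
    ∃ t, ∑ k ∈ Finset.range p, s ^ k = p * t ∧ ¬ p ∣ t := by
  suffices h : (p : ℤ) ^ 2 ∣ ∑ k ∈ Finset.range p, (s : ℤ) ^ k - p by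
    obtain ⟨c, hc⟩ := h
    have hc' : ((∑ k ∈ Finset.range p, s ^ k : ℕ) : ℤ) = p * (1 + p * c) := by
      push_cast; linear_combination hc
    obtain ⟨t, ht⟩ : p ∣ ∑ k ∈ Finset.range p, s ^ k := by
      rw [← Int.natCast_dvd_natCast, hc']; exact dvd_mul_right _ _
    refine ⟨t, ht, fun hd => hp.one_lt.ne' ?_⟩
    rw [ht, Nat.cast_mul] at hc'
    have hc2 := mul_left_cancel₀ (by exact_mod_cast hp.ne_zero) hc'
    have : (p : ℤ) ∣ 1 := by
      have h1 : (p : ℤ) ∣ t := by exact_mod_cast hd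
      rw [hc2] at h1
      exact (dvd_add_left (dvd_mul_right _ _)).1 h1
    exact Nat.dvd_one.1 (by exact_mod_cast this)
  rcases hs with ⟨h2, h1⟩ | ⟨rfl, h1⟩
  · obtain ⟨b, hb⟩ := h1.symm.dvd
    have := odd_sq_dvd_geom_sum₂_sub (a := (1 : ℤ)) (b := b) (hp.odd_of_ne_two h2)
    have hs : (s : ℤ) = 1 + p * b := by push_cast at hb; linear_combination hb
    simpa [hs] using this
  · obtain ⟨b, hb⟩ := h1.symm.dvd
    refine ⟨b, ?_⟩
    simp [Finset.sum_range_succ] at hb ⊢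
    linear_combination hb

/-- Let `zpowers a` be self-centralizing and normal, and let `g` have order `p` modulo it, acting by
`s`. The geometric sum argument forces `g` into `zpowers a` unless `p = 2` and `s ≡ 3 [MOD 4]`. -/
theorem HasUniquePrimeSubgroup.exists_orderOf_four {p : ℕ} [Fact p.Prime] {G : Type*} [Group G]
    [Finite G] (H : HasUniquePrimeSubgroup p G) (hG : IsPGroup p G)
    (hnonab : ∃ g h : G, g * h ≠ h * g) :
    p = 2 ∧ ∃ a g : G, (zpowers a).Normal ∧ g ∉ zpowers a ∧ orderOf g = 4 ∧ 4 ∣ orderOf a ∧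
      ∃ s, s ≡ 3 [MOD 4] ∧ g * a * g⁻¹ = a ^ s := by
  have hp : p.Prime := Fact.out
  obtain ⟨A, hAn, hAc, hAs⟩ := hG.exists_normal_abelian_self_centralizing
  obtain ⟨a, rfl⟩ := H.exists_generator hG A hAc
  have hself : ∀ x, x * a = a * x → x ∈ zpowers a := fun x hx => hAs x fun y hy => by
    obtain ⟨n, rfl⟩ := mem_zpowers_iff.1 hy
    exact (Commute.zpow_right hx n)
  obtain ⟨g, hg, hgp⟩ : ∃ g, g ∉ zpowers a ∧ g ^ p ∈ zpowers a := by
    obtain ⟨x, y, hxy⟩ := hnonab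
    have hx : ∃ x, x ∉ zpowers a := by
      by_contra! h
      exact hxy (hAc x (h x) y (h y))
    obtain ⟨x, hx⟩ := hx
    obtain ⟨i, hi⟩ := (hG.to_quotient (zpowers a)).exists_pow_order_prime
      (a := (x : G ⧸ zpowers a)) (by simpa [QuotientGroup.eq_one_iff] using hx)
    obtain ⟨h1, h2⟩ := orderOf_eq_prime_iff.1 hi
    refine ⟨x ^ i, fun h => h2 ?_, ?_⟩
    · rwa [← QuotientGroup.mk_pow, QuotientGroup.eq_one_iff]
    · rwa [← QuotientGroup.eq_one_iff, QuotientGroup.mk_pow, QuotientGroup.mk_pow]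
  have ha1 : a ≠ 1 := by
    rintro rfl
    exact hg (hself g (by simp))
  obtain ⟨k, hk⟩ := IsPGroup.iff_orderOf.1 hG a
  have hk0 : k ≠ 0 := by
    rintro rfl
    exact ha1 (orderOf_eq_one_iff.1 (by simpa using hk))
  obtain ⟨s, hs⟩ := mem_powers_iff_mem_zpowers.2 (hAn.conj_mem a (mem_zpowers a) g)
  replace hs : g * a * g⁻¹ = a ^ s := hs.symm
  have hs1 : ¬ s ≡ 1 [MOD orderOf a] := fun h => by
    rw [← pow_eq_pow_iff_modEq, pow_one, ← hs] at h
    exact hg (hself g (mul_inv_eq_iff_eq_mul.1 h))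
  have hiter : ∀ n, g ^ n * a * (g ^ n)⁻¹ = a ^ s ^ n := by
    intro n
    induction n with
    | zero => simp
    | succ n ih =>
      rw [pow_succ' g, pow_succ', pow_mul, ← hs, conj_pow, ← ih]
      group
  have hsp : s ^ p ≡ 1 [MOD orderOf a] := by
    rw [← pow_eq_pow_iff_modEq, pow_one, ← hiter, mul_inv_eq_iff_eq_mul]
    exact hAc _ hgp _ (mem_zpowers a)
  have hpa : p ∣ orderOf a := hG.dvd_orderOf ha1
  have hsp1 : s ≡ 1 [MOD p] := by
    have h1 : s ^ p ≡ 1 [MOD p] := hsp.of_dvd hpa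
    rw [← ZMod.natCast_eq_natCast_iff] at h1 ⊢
    push_cast at h1
    simpa using h1
  obtain ⟨j, hj⟩ := mem_powers_iff_mem_zpowers.2 hgp
  replace hj : a ^ j = g ^ p := hj
  -- Otherwise `g ^ p` generates `zpowers a`, so `g` centralizes it.
  obtain ⟨j, rfl⟩ : p ∣ j := by
    by_contra hpj
    have := mem_zpowers_pow_of_coprime (hG.coprime_orderOf a hpj)
    rw [hj] at this
    obtain ⟨n, hn⟩ := mem_zpowers_iff.1 this
    refine hg (hself g ?_)
    rw [← hn]
    exact ((Commute.refl g).pow_right p).zpow_right n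
  have hnot : ¬ ((p ≠ 2 ∧ s ≡ 1 [MOD p]) ∨ (p = 2 ∧ s ≡ 1 [MOD 4])) := fun h => by
    obtain ⟨t, ht, hpt⟩ := exists_geom_sum_eq_prime_mul hp h
    exact hg (H.mem_zpowers_of_geom_sum hG ha1 hs hj.symm ht hpt)
  obtain rfl : p = 2 := by
    by_contra h2
    exact hnot (Or.inl ⟨h2, hsp1⟩)
  have hs3 : s ≡ 3 [MOD 4] := by
    have : ¬ s ≡ 1 [MOD 4] := fun h => hnot (Or.inr ⟨rfl, h⟩)
    unfold Nat.ModEq at *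
    omega
  have h4 : 4 ∣ orderOf a := by
    have hk1 : k ≠ 1 := by
      rintro rfl
      exact hs1 (by rw [hk, pow_one]; exact hsp1)
    rw [hk]
    exact pow_dvd_pow 2 (show 2 ≤ k by omega)
  refine ⟨rfl, a, g, hAn, hg, ?_, h4, s, hs3, hs⟩
  refine orderOf_eq_prime_pow (p := 2) (n := 1)
    (fun h => hg (H.mem_zpowers_of_ne_one hG ha1 (by simpa using h))) ?_
  -- `g` fixes `g ^ 2 = a ^ (2 * j)`, which is thus killed by `s - 1`, twice an odd number; hence `g
  -- ^ 4 = 1`.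
  have hfix : (a ^ (2 * j)) ^ s = a ^ (2 * j) := by
    rw [pow_right_comm, ← hs, conj_pow, hj]
    group
  obtain ⟨u, rfl⟩ : ∃ u, s = 2 * u + 1 := ⟨s / 2, by unfold Nat.ModEq at hs3; omega⟩
  have hu : ¬ 2 ∣ u := by unfold Nat.ModEq at hs3; omega
  have h1 : (a ^ (2 * j)) ^ (2 * u) = 1 := by
    rwa [pow_succ, mul_eq_right] at hfix
  rw [pow_mul, ← orderOf_dvd_iff_pow_eq_one] at h1
  have h2 := orderOf_eq_one_iff.1
    (Nat.Coprime.eq_one_of_dvd (hG.coprime_orderOf _ hu) h1)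
  rw [hj] at h2
  rw [show 2 ^ (1 + 1) = 2 * 2 from rfl, pow_mul, h2]

/-- A square acts on `zpowers a` by a square exponent, and 3 is not a square modulo 4. -/
theorem pow_two_ne_of_conj_eq_pow {G : Type*} [Group G] {a g : G} {s : ℕ} [Finite G]
    (hn : (zpowers a).Normal) (ha : 4 ∣ orderOf a) (hs : s ≡ 3 [MOD 4])
    (h : g * a * g⁻¹ = a ^ s) (b : G) : b ^ 2 ≠ g := by
  rintro rfl
  obtain ⟨t, ht⟩ := mem_powers_iff_mem_zpowers.2 (hn.conj_mem a (mem_zpowers a) b)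
  replace ht : a ^ t = b * a * b⁻¹ := ht
  have h2 : a ^ (t * t) = a ^ s := by
    rw [← h, pow_mul, ht, conj_pow, ht, pow_two]
    group
  have h3 : t * t ≡ 3 [MOD 4] := ((pow_eq_pow_iff_modEq.1 h2).of_dvd ha).trans hs
  have h4 : t % 4 < 4 := Nat.mod_lt _ (by norm_num)
  unfold Nat.ModEq at h3
  rw [Nat.mul_mod] at h3
  interval_cases t % 4 <;> simp at h3

/-! ### Recognizing `Q_8` -/

theorem nonempty_mulEquiv_quaternionGroup_two {G : Type*} [Group G] [Finite G]
    (hcard : Nat.card G = 8) {x g : G} (hx : orderOf x = 4) (hg : g ∉ zpowers x)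
    (hgx : g * x * g⁻¹ = x⁻¹) (hg2 : g ^ 2 = x ^ 2) : Nonempty (G ≃* QuaternionGroup 2) := by
  set e : ZMod (2 * 2) → G := fun i => x ^ i.val with he
  have hadd : ∀ i j, e (i + j) = e i * e j := fun i j => by
    simp only [he]
    rw [ZMod.val_add, ← pow_add, pow_eq_pow_iff_modEq, hx]
    exact Nat.mod_modEq _ _
  have hsub : ∀ i j, e (i - j) = (e j)⁻¹ * e i := fun i j => by
    rw [eq_inv_mul_iff_mul_eq, ← hadd, add_sub_cancel]
  have htwo : e (2 : ℕ) = g * g := by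
    rw [← pow_two g, hg2]
    rfl
  have hconj : ∀ i, e i * g = g * (e i)⁻¹ := fun i => by
    have : g * e i * g⁻¹ = (e i)⁻¹ := by simp only [he]; rw [← conj_pow, hgx, inv_pow]
    rw [← this]
    have h2 : g * g * e i = e i * (g * g) := by rw [← htwo, ← hadd, ← hadd, add_comm]
    rw [← mul_assoc, ← mul_assoc, h2]
    group
  let f : QuaternionGroup 2 →* G := MonoidHom.mk' (fun q => match q with
    | .a i => e i
    | .xa i => g * e i) (by
      rintro (i | i) (j | j)
      · exact hadd i j
      · change g * e (j - i) = e i * (g * e j)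
        rw [← mul_assoc, hconj, mul_assoc, hsub]
      · change g * e (i + j) = g * e i * e j
        rw [hadd, mul_assoc]
      · change e ((2 : ℕ) + j - i) = g * e i * (g * e j)
        rw [add_sub_assoc, hadd, hsub, htwo, ← mul_assoc (g * e i), mul_assoc g (e i), hconj]
        simp only [mul_assoc])
  have hinj : Function.Injective f := by
    rw [injective_iff_map_eq_one]
    rintro (i | i) h
    · have h1 : x ^ i.val = 1 := h
      rw [← orderOf_dvd_iff_pow_eq_one, hx] at h1
      have h2 := Nat.eq_zero_of_dvd_of_lt h1 (ZMod.val_lt i)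
      rw [(ZMod.val_eq_zero i).1 h2, QuaternionGroup.a_zero]
    · have h1 : g * x ^ i.val = 1 := h
      exact (hg (((zpowers x).mul_mem_cancel_right (npow_mem_zpowers x _)).1
        (h1 ▸ one_mem _))).elim
  have hbij : Function.Bijective f := (Nat.bijective_iff_injective_and_card f).2
    ⟨hinj, by rw [hcard, Nat.card_eq_fintype_card, QuaternionGroup.card]⟩
  exact ⟨(MulEquiv.ofBijective f hbij).symm⟩

theorem HasUniquePrimeSubgroup.nonempty_mulEquiv_quaternionGroup_two {G : Type*} [Group G]
    [Finite G] (H : HasUniquePrimeSubgroup 2 G) (hcard : Nat.card G = 8)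
    (hnonab : ∃ g h : G, g * h ≠ h * g) : Nonempty (G ≃* QuaternionGroup 2) := by
  have : Fact (Nat.Prime 2) := ⟨Nat.prime_two⟩
  have hG : IsPGroup 2 G := IsPGroup.of_card (n := 3) hcard
  obtain ⟨-, a, g, -, hg, hgo, ha, s, hs, hconj⟩ := H.exists_orderOf_four hG hnonab
  have ha4 : orderOf a = 4 := by
    have h8 : orderOf a ∣ 8 := hcard ▸ orderOf_dvd_natCard a
    have hne : orderOf a ≠ 8 := fun h => hg <| by
      rw [(card_eq_iff_eq_top (zpowers a)).1 (by rw [Nat.card_zpowers, h, hcard])]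
      exact mem_top g
    have := Nat.le_of_dvd (by norm_num) h8
    interval_cases orderOf a <;> omega
  refine _root_.nonempty_mulEquiv_quaternionGroup_two hcard ha4 hg ?_ ?_
  · rw [hconj, eq_inv_iff_mul_eq_one, ← pow_succ, ← orderOf_dvd_iff_pow_eq_one, ha4]
    unfold Nat.ModEq at hs
    omega
  · have hne : ∀ x : G, orderOf x = 4 → x ^ 2 ≠ 1 ∧ (x ^ 2) ^ 2 = 1 := fun x hx =>
      ⟨pow_ne_one_of_lt_orderOf (by norm_num) (by omega), by
        rw [← pow_mul, ← orderOf_dvd_iff_pow_eq_one, hx]⟩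
    obtain ⟨h1, h2⟩ := hne g hgo
    obtain ⟨h3, h4⟩ := hne a ha4
    obtain ⟨n, hn⟩ := mem_zpowers_iff.1 (H (a ^ 2) (g ^ 2) h4 h3 h2)
    rw [← hn]
    rcases Int.even_or_odd' n with ⟨k, rfl | rfl⟩
    -- An even exponent would give `g ^ 2 = 1`.
    · refine (h1 ?_).elim
      rw [← hn, zpow_mul, zpow_ofNat, h4, one_zpow]
    · rw [zpow_add, zpow_mul, zpow_ofNat, h4, one_zpow, one_mul, zpow_one]

/-! ### `𝒫(p)` in `p`-groups -/

theorem IsPGroup.rootCount_eq_one {p l : ℕ} {G : Type*} [Group G] (hG : IsPGroup p G)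
    (hl : p.Coprime l) (x : G) : rootCount l x = 1 := by
  refine Nat.card_eq_one_iff_exists.2 ⟨⟨(hG.powEquiv hl).symm x, (hG.powEquiv hl).apply_symm_apply x⟩, ?_⟩
  rintro ⟨y, hy⟩
  exact Subtype.ext ((hG.powEquiv hl).eq_symm_apply.2 hy)

/-- For `1 < l < p` the `l`-th power map is bijective, so only `p`-th roots matter. -/
theorem IsPGroup.satisfiesP_iff {p : ℕ} [Fact p.Prime] {G : Type*} [Group G] [Finite G]
    (hG : IsPGroup p G) :
    SatisfiesP p G ↔ ∃ a c : G, orderOf a = orderOf (c ^ p) ∧ ∀ b, b ^ p ≠ a := by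
  constructor
  · rintro ⟨a, b, hab, ha, hb, -⟩
    obtain ⟨⟨c, rfl⟩⟩ := (Nat.card_pos_iff.1 hb).1
    refine ⟨a, c, hab, fun b hb => ?_⟩
    have : IsEmpty {g : G // g ^ p = a} := (Finite.card_eq_zero_iff).1 ha
    exact this.false ⟨b, hb⟩
  · rintro ⟨a, c, hac, ha⟩
    refine ⟨a, c ^ p, hac, ?_, ?_, fun l _ h1 h2 => ?_⟩
    · exact Finite.card_eq_zero_iff.2 ⟨fun b => ha b b.2⟩
    · exact Nat.card_pos_iff.2 ⟨⟨⟨c, rfl⟩⟩, inferInstance⟩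
    · have hl : p.Coprime l := (Nat.coprime_of_lt_prime (by omega) h2 Fact.out)
      rw [hG.rootCount_eq_one hl, hG.rootCount_eq_one hl]

theorem IsPGroup.prod {p : ℕ} [Fact p.Prime] {G K : Type*} [Group G] [Group K] [Finite G]
    [Finite K] (hG : IsPGroup p G) (hK : IsPGroup p K) : IsPGroup p (G × K) := by
  obtain ⟨m, hm⟩ := IsPGroup.iff_card.1 hG
  obtain ⟨n, hn⟩ := IsPGroup.iff_card.1 hK
  exact IsPGroup.of_card (n := m + n) (by rw [Nat.card_prod, hm, hn, pow_add])

theorem IsPGroup.satisfiesP_prod {p : ℕ} [Fact p.Prime] {G K : Type*} [Group G] [Group K]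
    [Finite G] [Finite K] (hG : IsPGroup p G) (hK : IsPGroup p K)
    (h : SatisfiesP p G ∨ SatisfiesP p K) : SatisfiesP p (G × K) := by
  rw [(hG.prod hK).satisfiesP_iff]
  rcases h with h | h
  · obtain ⟨a, c, hac, ha⟩ := hG.satisfiesP_iff.1 h
    exact ⟨(a, 1), (c, 1), by simp [Prod.orderOf, hac], fun b hb => ha b.1 (congrArg Prod.fst hb)⟩
  · obtain ⟨a, c, hac, ha⟩ := hK.satisfiesP_iff.1 h
    exact ⟨(1, a), (1, c), by simp [Prod.orderOf, hac], fun b hb => ha b.2 (congrArg Prod.snd hb)⟩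

theorem IsPGroup.orderOf_of_pow {p : ℕ} [Fact p.Prime] {G : Type*} [Group G] [Finite G]
    (hG : IsPGroup p G) {b : G} (h : b ≠ 1) : orderOf b = p * orderOf (b ^ p) := by
  rw [orderOf_pow_of_dvd (Nat.Prime.ne_zero Fact.out) (hG.dvd_orderOf h),
    Nat.mul_div_cancel' (hG.dvd_orderOf h)]

/-! ### Failure of `𝒫(p)` and uniqueness -/

theorem IsPGroup.exists_mem_zpowers_of_not_satisfiesP {p : ℕ} [Fact p.Prime] {G : Type*} [Group G]
    [Finite G] (hG : IsPGroup p G) (hP : ¬ SatisfiesP p G) {y w : G} {m : ℕ}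
    (hy : orderOf y = p ^ m) (hm : m ≠ 0) (hw : orderOf w = p) :
    ∃ z, orderOf z = p ^ m ∧ w ∈ zpowers z := by
  have hp : p.Prime := Fact.out
  suffices h : ∀ d j w, j ≠ 0 → m = j + d → orderOf w = p ^ j →
      ∃ z, orderOf z = p ^ m ∧ w ∈ zpowers z by
    exact h (m - 1) 1 w one_ne_zero (by omega) (by simpa using hw)
  intro d
  induction d with
  | zero => exact fun j w _ hj hw => ⟨w, by rw [hw, hj, add_zero], mem_zpowers w⟩
  | succ d ih =>
    intro j w hj0 hj hw
    obtain ⟨b, rfl⟩ : ∃ b, b ^ p = w := by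
      by_contra! hb
      -- The `p`-th power of `y ^ p ^ d` has order `p ^ j`, like `w`.
      refine hP (hG.satisfiesP_iff.2 ⟨w, y ^ p ^ d, ?_, hb⟩)
      rw [hw, ← pow_mul, ← pow_succ, orderOf_pow_of_dvd (pow_ne_zero _ hp.ne_zero)
        (hy ▸ pow_dvd_pow p (by omega)), hy, Nat.pow_div (by omega) hp.pos]
      congr 1
      omega
    have hb1 : b ≠ 1 := by
      rintro rfl
      rw [one_pow, orderOf_one] at hw
      exact (Nat.one_lt_pow hj0 hp.one_lt).ne hw
    obtain ⟨z, hz, hbz⟩ := ih (j + 1) b (by omega) (by omega)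
      (by rw [hG.orderOf_of_pow hb1, hw, pow_succ'])
    exact ⟨z, hz, pow_mem hbz p⟩

theorem IsPGroup.mem_zpowers_of_mem_zpowers {p : ℕ} [Fact p.Prime] {G : Type*} [Group G]
    [Finite G] (hG : IsPGroup p G) {x w z : G} (hx : x ∈ zpowers z) (hw : w ∈ zpowers z)
    (hxp : x ^ p = 1) (hx1 : x ≠ 1) (hwp : w ^ p = 1) : w ∈ zpowers x := by
  have hp : p.Prime := Fact.out
  obtain ⟨i, hi⟩ := mem_powers_iff_mem_zpowers.2 hx
  obtain ⟨k, hk⟩ := mem_powers_iff_mem_zpowers.2 hw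
  replace hi : z ^ i = x := hi
  replace hk : z ^ k = w := hk
  have hz1 : z ≠ 1 := by
    rintro rfl
    exact hx1 (by rw [← hi, one_pow])
  obtain ⟨M, hM⟩ := hG.dvd_orderOf hz1
  have key : ∀ n, (z ^ n) ^ p = 1 → M ∣ n := fun n hn => by
    rw [← pow_mul, ← orderOf_dvd_iff_pow_eq_one, hM, mul_comm n] at hn
    exact Nat.dvd_of_mul_dvd_mul_left hp.pos hn
  obtain ⟨i, rfl⟩ := key i (hi ▸ hxp)
  obtain ⟨k, rfl⟩ := key k (hk ▸ hwp)
  have hpi : ¬ p ∣ i := fun ⟨c, hc⟩ => hx1 <| by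
    rw [← hi, ← orderOf_dvd_iff_pow_eq_one, hM, hc]
    exact ⟨c, by ring⟩
  have := mem_zpowers_pow_of_coprime (hG.coprime_orderOf (z ^ M) hpi)
  rw [← pow_mul, hi] at this
  rw [← hk, pow_mul]
  exact pow_mem this k

theorem exists_ne_one_mem_zpowers_inter {G : Type*} [Group G] [Finite G] {y z : G}
    (h : Nat.card G < orderOf y * orderOf z) : ∃ c ≠ 1, c ∈ zpowers y ∧ c ∈ zpowers z := by
  by_contra! hc
  have hd : Disjoint (zpowers y) (zpowers z) := disjoint_def.2 fun {c} h1 h2 => by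
    by_contra h
    exact hc c h h1 h2
  have := Nat.card_le_card_of_injective _ (mul_injective_of_disjoint hd)
  rw [Nat.card_prod, Nat.card_zpowers, Nat.card_zpowers] at this
  omega

theorem IsPGroup.hasUniquePrimeSubgroup_of_card_lt {p : ℕ} [Fact p.Prime] {G : Type*} [Group G]
    [Finite G] (hG : IsPGroup p G) (hP : ¬ SatisfiesP p G) {y : G} {m : ℕ}
    (hy : orderOf y = p ^ m) (hm : m ≠ 0) (hcard : Nat.card G < p ^ m * p ^ m) :
    HasUniquePrimeSubgroup p G := by
  have key : ∀ w : G, w ^ p = 1 → w ≠ 1 → w ∈ zpowers y := by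
    intro w hw hw1
    obtain ⟨z, hz, hwz⟩ := hG.exists_mem_zpowers_of_not_satisfiesP hP hy hm
      (orderOf_eq_prime hw hw1)
    obtain ⟨c, hc1, hcy, hcz⟩ := exists_ne_one_mem_zpowers_inter (y := y) (z := z)
      (by rwa [hy, hz])
    obtain ⟨i, hi⟩ := hG.exists_pow_order_prime hc1
    obtain ⟨h1, h2⟩ := orderOf_eq_prime_iff.1 hi
    exact zpowers_le.2 (pow_mem hcy i) (hG.mem_zpowers_of_mem_zpowers (pow_mem hcz i) hwz h1 h2 hw)
  intro u w hu hu1 hw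
  by_cases hw1 : w = 1
  · exact hw1 ▸ one_mem _
  · exact hG.mem_zpowers_of_mem_zpowers (key u hu hu1) (key w hw hw1) hu hu1 hw

theorem HasUniquePrimeSubgroup.satisfiesP {p : ℕ} [Fact p.Prime] {G : Type*} [Group G]
    [Finite G] (H : HasUniquePrimeSubgroup p G) (hG : IsPGroup p G)
    (hnonab : ∃ g h : G, g * h ≠ h * g) {y : G} {e : ℕ} (hy : orderOf y = p ^ e)
    (he : p = 2 → 3 ≤ e) : SatisfiesP p G := by
  obtain ⟨rfl, a, g, hn, -, hgo, ha, s, hs, hconj⟩ := H.exists_orderOf_four hG hnonab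
  have he := he rfl
  refine hG.satisfiesP_iff.2 ⟨g, y ^ 2 ^ (e - 3), ?_, pow_two_ne_of_conj_eq_pow hn ha hs hconj⟩
  rw [hgo, ← pow_mul, ← pow_succ, orderOf_pow_of_dvd (by positivity)
    (hy ▸ pow_dvd_pow 2 (by omega)), hy, Nat.pow_div (by omega) two_pos,
    show e - (e - 3 + 1) = 2 by omega]
  norm_num

theorem IsPGroup.satisfiesP_of_card {p : ℕ} [Fact p.Prime] {G : Type*} [Group G] [Finite G]
    (hG : IsPGroup p G) (hnonab : ∃ g h : G, g * h ≠ h * g) {m n : ℕ} (hn : 1 ≤ n) (hnm : n < m)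
    (hcard : Nat.card G = p ^ (m + n)) (hQ : ¬ Nonempty (G ≃* QuaternionGroup 2)) {y : G}
    (hy : orderOf y = p ^ m) : SatisfiesP p G := by
  have hp : p.Prime := Fact.out
  by_contra hP
  have H := hG.hasUniquePrimeSubgroup_of_card_lt hP hy (by omega)
    (by rw [hcard, ← pow_add]; exact Nat.pow_lt_pow_right hp.one_lt (by omega))
  by_cases h : p = 2 → 3 ≤ m
  · exact hP (H.satisfiesP hG hnonab hy h)
  -- The only remaining case is `p = 2`, `m = 2`, `n = 1`, of order 8.
  · push Not at h
    obtain ⟨rfl, hm⟩ := h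
    obtain rfl : m = 2 := by omega
    obtain rfl : n = 1 := by omega
    exact hQ (H.nonempty_mulEquiv_quaternionGroup_two hcard hnonab)

/-! ### Quotients by a central subgroup of order `p` -/

theorem IsPGroup.hasUniquePrimeSubgroup_of_forall_mem_zpowers {p : ℕ} [Fact p.Prime] {G : Type*}
    [Group G] [Finite G] (hG : IsPGroup p G) (hP : ¬ SatisfiesP p G) {y α : G} {e : ℕ}
    (hy : orderOf y = p ^ e) (he : e ≠ 0) (hα : orderOf α = p)
    (h : ∀ z, orderOf z = p ^ e → α ∈ zpowers z) : HasUniquePrimeSubgroup p G := by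
  obtain ⟨hαp, hα1⟩ := orderOf_eq_prime_iff.1 hα
  intro u w hu hu1 hw
  by_cases hw1 : w = 1
  · exact hw1 ▸ one_mem _
  obtain ⟨z, hz, huz⟩ := hG.exists_mem_zpowers_of_not_satisfiesP hP hy he (orderOf_eq_prime hu hu1)
  obtain ⟨z', hz', hwz'⟩ :=
    hG.exists_mem_zpowers_of_not_satisfiesP hP hy he (orderOf_eq_prime hw hw1)
  exact zpowers_le.2 (hG.mem_zpowers_of_mem_zpowers huz (h z hz) hu hu1 hαp)
    (hG.mem_zpowers_of_mem_zpowers (h z' hz') hwz' hαp hα1 hw)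

/-- Modulo `α` the order of `y` drops by a factor `p` while that of `z` does not, so `y` and `z ^ p`
get equal orders. A `p`-th root of the image of `y` would lift to an element of order exceeding the
exponent `p ^ (k + 2)`. -/
theorem IsPGroup.satisfiesP_quotient {p : ℕ} [Fact p.Prime] {G : Type*} [Group G] [Finite G]
    (hG : IsPGroup p G) (α : center G) (hα : orderOf (α : G) = p) {y z : G} {k : ℕ}
    (hexp : ∀ u : G, u ^ p ^ (k + 2) = 1) (hy : orderOf y = p ^ (k + 2))
    (hz : orderOf z = p ^ (k + 2)) (hαy : (α : G) ∈ zpowers y) (hαz : (α : G) ∉ zpowers z) :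
    SatisfiesP p (G ⧸ zpowers (α : G)) := by
  have hp : p.Prime := Fact.out
  obtain ⟨hαp, hα1⟩ := orderOf_eq_prime_iff.1 hα
  have hord : ∀ x : G, orderOf x = p ^ (k + 2) → ∀ i ≤ k + 1, x ^ p ^ i ≠ 1 := fun x hx i hi =>
    pow_ne_one_of_lt_orderOf (pow_ne_zero _ hp.ne_zero)
      (hx ▸ Nat.pow_lt_pow_right hp.one_lt (by omega))
  have hmem : ∀ c ∈ zpowers (α : G), c ^ p = 1 := fun c hc => by
    rw [← orderOf_dvd_iff_pow_eq_one, ← hα]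
    exact orderOf_dvd_of_mem_zpowers hc
  refine (hG.to_quotient _).satisfiesP_iff.2 ⟨(y : G ⧸ zpowers (α : G)), z, ?_, ?_⟩
  · trans p ^ (k + 1)
    · refine orderOf_eq_prime_pow ?_ ?_
      · rw [← QuotientGroup.mk_pow, QuotientGroup.eq_one_iff]
        intro h
        have := hmem _ h
        rw [← pow_mul, ← pow_succ] at this
        exact hord y hy _ le_rfl this
      · rw [← QuotientGroup.mk_pow, QuotientGroup.eq_one_iff]
        exact hG.mem_zpowers_of_mem_zpowers hαy (npow_mem_zpowers y _) hαp hα1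
          (by rw [← pow_mul, ← pow_succ]; exact hexp y)
    · refine (orderOf_eq_prime_pow ?_ ?_).symm
      · rw [← pow_mul, ← pow_succ', ← QuotientGroup.mk_pow, QuotientGroup.eq_one_iff]
        intro h
        exact hαz (zpowers_le.2 (npow_mem_zpowers z _) (hG.mem_zpowers_of_mem_zpowers h
          (mem_zpowers _) (hmem _ h) (hord z hz _ le_rfl) hαp))
      · rw [← pow_mul, ← pow_succ', ← QuotientGroup.mk_pow, hexp, QuotientGroup.mk_one]
  · intro b hb
    obtain ⟨u, rfl⟩ := QuotientGroup.mk_surjective b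
    rw [← QuotientGroup.mk_pow, eq_comm, QuotientGroup.eq] at hb
    obtain ⟨n, hn⟩ := mem_zpowers_iff.1 hb
    have hc : Commute y ((α : G) ^ n) := Commute.zpow_right (mem_center_iff.1 α.2 y) n
    refine hord y hy (k + 1) le_rfl ?_
    calc y ^ p ^ (k + 1) = (y * (α : G) ^ n) ^ p ^ (k + 1) := by
          rw [hc.mul_pow, pow_succ' p k, pow_mul ((α : G) ^ n), hn, hmem _ hb, one_pow, mul_one]
      _ = u ^ p ^ (k + 2) := by
          rw [hn, mul_inv_cancel_left, ← pow_mul, ← pow_succ']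
      _ = 1 := hexp u

theorem IsPGroup.satisfiesP_or_quotient {p : ℕ} [Fact p.Prime] {G : Type*} [Group G] [Finite G]
    (hG : IsPGroup p G) (hnonab : ∃ g h : G, g * h ≠ h * g)
    (hy : ∃ y : G, max (p ^ 2) 8 ≤ orderOf y) (hP : ¬ SatisfiesP p G) (α : center G)
    (hα : orderOf (α : G) = p) : SatisfiesP p (G ⧸ zpowers (α : G)) := by
  have hp : p.Prime := Fact.out
  obtain ⟨x, hx⟩ := hy
  obtain ⟨y, hmax⟩ := Finite.exists_max (fun x : G => orderOf x)
  replace hx := hx.trans (hmax x)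
  obtain ⟨e, he⟩ := IsPGroup.iff_orderOf.1 hG y
  rw [he] at hx
  have he2 : 2 ≤ e := (Nat.pow_le_pow_iff_right hp.one_lt).1 ((le_max_left _ _).trans hx)
  have he3 : p = 2 → 3 ≤ e := by
    rintro rfl
    exact (Nat.pow_le_pow_iff_right (a := 2) (n := 3) one_lt_two).1 ((le_max_right _ _).trans hx)
  by_cases h : ∀ z, orderOf z = p ^ e → (α : G) ∈ zpowers z
  · exact (hP ((hG.hasUniquePrimeSubgroup_of_forall_mem_zpowers hP he (by omega) hα h).satisfiesP
      hG hnonab he he3)).elim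
  push Not at h
  obtain ⟨z, hz, hαz⟩ := h
  obtain ⟨y', hy', hαy'⟩ := hG.exists_mem_zpowers_of_not_satisfiesP hP he (by omega) hα
  obtain ⟨k, rfl⟩ := Nat.exists_eq_add_of_le' he2
  refine hG.satisfiesP_quotient α hα (fun u => ?_) hy' hz hαy' hαz
  obtain ⟨i, hi⟩ := IsPGroup.iff_orderOf.1 hG u
  have := hmax u
  rw [hi, he, Nat.pow_le_pow_iff_right hp.one_lt] at this
  rw [← orderOf_dvd_iff_pow_eq_one, hi]
  exact pow_dvd_pow p this

theorem theorem3p13 (p : ℕ) (hp : p.Prime) (G : Type*) [Group G] [Finite G]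
    (hG : IsPGroup p G) (hnonab : ∃ g h : G, g * h ≠ h * g) :
    (∀ m n : ℕ, 1 ≤ n → n < m → Nat.card G = p ^ (m + n) →
      ¬ Nonempty (G ≃* QuaternionGroup 2) →
      (∃ y : G, orderOf y = p ^ m) →
      SatisfiesP p G) ∧
    ((∃ y : G, max (p ^ 2) 8 ≤ orderOf y) →
      (SatisfiesP p G ∨
        ∀ α : Subgroup.center G, orderOf (α : G) = p →
          SatisfiesP p (G ⧸ Subgroup.zpowers (α : G))) ∧
      ∀ α : Subgroup.center G, orderOf (α : G) = p →
        SatisfiesP p (G × (G ⧸ Subgroup.zpowers (α : G)))) := by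
  have : Fact p.Prime := ⟨hp⟩
  refine ⟨fun m n hn hnm hcard hQ ⟨y, hy⟩ =>
    hG.satisfiesP_of_card hnonab hn hnm hcard hQ hy, fun hy => ?_⟩
  have h := fun hP => hG.satisfiesP_or_quotient hnonab hy hP
  refine ⟨or_iff_not_imp_left.2 h, fun α hα => ?_⟩
  exact hG.satisfiesP_prod (hG.to_quotient _) (or_iff_not_imp_left.2 fun hP => h hP α hα)
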